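/- **Setting.** Let $J^*>0$, let $T\subset[0,\infty)$ be a nonempty compact set (temperatures), $Q$ a nonempty compact subset of a metric space (external parameters), $\tilde X\subset[0,\infty)$ a terminal set, $x_0\ge 0$ an initial humidity, and let $f(x,t,\alpha)$ and $e(t,\alpha,x,\tau)$ be given real functions. For $0\le a\le b$, a control of the operator (of nature) over $[a,b]$ is a measurable function $[a,b]\to T$ ($[a,b]\to Q$). A trajectory on $[0,s]$ for a pair of controls $(t,\alpha)$ over $[0,s]$ is an absolutely continuous $x:[0,s]\to[0,\infty)$ with $x(0)=x_0$ and $\dot x(\tau)=f(x(\tau),t(\tau),\alpha(\tau))$ for almost every $\tau$. Assume: 1. for every $s\in[0,J^*]$ and every pair of controls over $[0,s]$ there is exactly one trajectory on $[0,s]$; 2. every trajectory on $[0,J^*]$ meets $\tilde X$; put $\tau_x=\inf\{\tau\in[0,J^*]:x(\tau)\in\tilde X\}$; 3. for every pair of controls $(t,\alpha)$ over $[0,J^*]$ with trajectory $x$, the energy cost $E(t,\alpha,x)=\int_0^{\tau_x}e(t(\tau),\alpha(\tau),x(\tau),\tau)\,d\tau$ exists as a Lebesgue integral, and it is bounded uniformly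 over all pairs of controls. **The upper game $\bar\Gamma$.** A (piecewise-program) strategy $\bar T=(\sigma,\varphi_\sigma)$ of the operator, who minimizes $E$, consists of a finite partition $\sigma=\{0=\tau_0<\dots<\tau_n=J^*\}$ and, for each $k<n$, a map that assigns to the humidity at time $\tau_k$ a control of the operator over $[\tau_k,\tau_{k+1}]$. A strategy $\bar\alpha=\{\psi_\sigma\}_\sigma$ of nature, who maximizes $E$, consists, for every finite partition $\sigma$ and each $k<n$, of a map that assigns to the humidity at time $\tau_k$ and the operator's control over $[\tau_k,\tau_{k+1}]$ a control of nature over $[\tau_k,\tau_{k+1}]$. A play of $(\bar T,\bar\alpha)$ is a pair of controls over $[0,J^*]$ with its trajectory $x$ such that on each $[\tau_k,\tau_{k+1})$ of the partition $\sigma$ of $\bar T$ the controls are the ones prescribed by $\varphi_\sigma$ and $\psi_\sigma$ from $x(\tau_k)$. **Theorem.** Every pair of strategies $(\bar T,\bar\alpha)$ has a play, and its play is unique (the trajectory is unique, and the controls are unique up to null sets); let $E(\bar T,\bar\alpha)$ be the energy cost of the play. For every $\varepsilon>0$ there is a pair of strategies $(\bar T^\varepsilon,\bar\alpha^\varepsilon)$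 such that, for all strategies $\bar T$ of the operator and $\bar\alpha$ of nature, $$E(\bar T^\varepsilon,\bar\alpha)-\varepsilon\;\le\;E(\bar T^\varepsilon,\bar\alpha^\varepsilon)\;\le\;E(\bar T,\bar\alpha^\varepsilon)+\varepsilon .$$ Moreover, if the operator follows $\bar T^\varepsilon$, then whatever control $\alpha(\cdot)$ over $[0,J^*]$ nature uses, the energy cost is at most $E(\bar T^\varepsilon,\bar\alpha^\varepsilon)+\varepsilon$. -/

import Mathlib

open Set MeasureTheory

noncomputable section

/-- An admissible control over `[a, b]` with values in `S`: a measurable function `[a, b] → S`. -/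
structure Control {X : Type*} [MeasurableSpace X] (S : Set X) (a b : ℝ) where
  toFun : Icc a b → X
  measurable' : Measurable toFun
  mem' : ∀ τ, toFun τ ∈ S

instance {X : Type*} [MeasurableSpace X] (S : Set X) (a b : ℝ) :
    CoeFun (Control S a b) (fun _ => Icc a b → X) :=
  ⟨Control.toFun⟩

/-- Lebesgue measure on the interval `[a, b]`. -/
def timeMeasure (a b : ℝ) : Measure (Icc a b) :=
  Measure.comap Subtype.val volume

/-- A finite partition `0 = t 0 < t 1 < ⋯ < t n = J` of the interval `[0, J]`. -/
structure TimePartition (J : ℝ) where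
  n : ℕ
  t : Fin (n + 1) → ℝ
  strictMono' : StrictMono t
  t_zero : t 0 = 0
  t_last : t (Fin.last n) = J

/-- The data of the drying game; `A` is the space in which the parameters of nature live. -/
structure DryingGame (A : Type*) where
  /-- the time horizon -/
  J : ℝ
  /-- the set of possible temperatures -/
  T : Set ℝ
  /-- the set of possible external parameters -/
  Q : Set A
  /-- the right-hand side `f(x, t, α)` of the equation of motion -/
  f : ℝ → ℝ → A → ℝ
  /-- the instantaneous energy cost `e(t, α, x, τ)` -/
  e : ℝ → A → ℝ → ℝ → ℝ
  /-- the initial humidity -/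
  x₀ : ℝ
  /-- the terminal set -/
  terminal : Set ℝ

namespace DryingGame

variable {A : Type*} [MeasurableSpace A] (G : DryingGame A)

/-- `x` is, on `[0, s]`, a trajectory corresponding to the controls `u` (operator) and `v` (nature):
an absolutely continuous function with values in `[0, ∞)` that starts at the initial humidity and
satisfies `x' = f(x, u, v)` almost everywhere. Only the values of `x` on `[0, s]` matter. -/
structure IsTrajectory (s : ℝ) (u : Control G.T 0 s) (v : Control G.Q 0 s) (x : ℝ → ℝ) :
    Prop where
  absCont : AbsolutelyContinuousOnInterval x 0 s
  nonneg : ∀ τ ∈ Icc 0 s, 0 ≤ x τ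
  init : x 0 = G.x₀
  ode : ∀ᵐ (τ : Icc 0 s) ∂(timeMeasure 0 s), HasDerivAt x (G.f (x τ) (u τ) (v τ)) τ

/-- The time at which `x` reaches the terminal set. -/
def reachTime (x : ℝ → ℝ) : ℝ :=
  sInf {τ | τ ∈ Icc 0 G.J ∧ x τ ∈ G.terminal}

/-- The energy cost: the integral of `e` from time `0` until the terminal set is reached. -/
def energy (u : Control G.T 0 G.J) (v : Control G.Q 0 G.J) (x : ℝ → ℝ) : ℝ :=
  ∫ τ in {τ : Icc 0 G.J | (τ : ℝ) ≤ G.reachTime x}, G.e (u τ) (v τ) (x τ) τ ∂(timeMeasure 0 G.J)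

/-- A piecewise-program strategy of the operator in the upper game: a finite partition `σ` and, for
each of its intervals `[t k, t (k+1)]`, a map from the humidity at time `t k` to a control over
that interval. -/
structure OperatorStrategy where
  σ : TimePartition G.J
  φ : (k : Fin σ.n) → ℝ → Control G.T (σ.t k.castSucc) (σ.t k.succ)

/-- A piecewise-program strategy of nature in the upper game: for every finite partition `σ` and
each of its intervals `[t k, t (k+1)]`, a map that takes the humidity at time `t k` and the control
of the operator over that interval to a control of nature over the same interval. -/
def NatureStrategy : Type _ :=
  (σ : TimePartition G.J) → (k : Fin σ.n) → ℝ → Control G.T (σ.t k.castSucc) (σ.t k.succ) →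
    Control G.Q (σ.t k.castSucc) (σ.t k.succ)

variable {G}

/-- Along the trajectory `x`, the control `u` is the one that the strategy `S` prescribes. -/
def OperatorStrategy.Follows (S : G.OperatorStrategy) (u : Control G.T 0 G.J) (x : ℝ → ℝ) : Prop :=
  ∀ (k : Fin S.σ.n) (τ : ℝ) (h : τ ∈ Icc 0 G.J) (hk : τ ∈ Icc (S.σ.t k.castSucc) (S.σ.t k.succ)),
    τ < S.σ.t k.succ → u ⟨τ, h⟩ = S.φ k (x (S.σ.t k.castSucc)) ⟨τ, hk⟩

/-- Along the trajectory `x`, the control `v` is the one that the strategy `N` of nature prescribes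
against the operator's strategy `S`. -/
def NatureStrategy.Follows (N : G.NatureStrategy) (S : G.OperatorStrategy)
    (v : Control G.Q 0 G.J) (x : ℝ → ℝ) : Prop :=
  ∀ (k : Fin S.σ.n) (τ : ℝ) (h : τ ∈ Icc 0 G.J) (hk : τ ∈ Icc (S.σ.t k.castSucc) (S.σ.t k.succ)),
    τ < S.σ.t k.succ →
      v ⟨τ, h⟩ = N S.σ k (x (S.σ.t k.castSucc)) (S.φ k (x (S.σ.t k.castSucc))) ⟨τ, hk⟩

/-- The controls `u`, `v` and the trajectory `x` over `[0, J]` arise when the operator plays `S` and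
nature plays `N`. -/
structure IsPlay (S : G.OperatorStrategy) (N : G.NatureStrategy) (u : Control G.T 0 G.J)
    (v : Control G.Q 0 G.J) (x : ℝ → ℝ) : Prop where
  traj : G.IsTrajectory G.J u v x
  operator : S.Follows u x
  nature : N.Follows S v x

open Classical in
/-- The payoff in the situation `(S, N)`: the energy cost of the play that it generates. -/
def payoff (S : G.OperatorStrategy) (N : G.NatureStrategy) : ℝ :=
  if h : ∃ p : Control G.T 0 G.J × Control G.Q 0 G.J × (ℝ → ℝ), IsPlay S N p.1 p.2.1 p.2.2 then
    G.energy h.choose.1 h.choose.2.1 h.choose.2.2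
  else 0

end DryingGame

end

/-!
The game is solved by backward induction over the moves of a partition. Two properties of the
dynamics, both consequences of the uniqueness of trajectories, make this possible: causality
(`WellPosed.traj_congr`: controls used after time `s` do not influence the trajectory up to `s`) and
the Markov property (`WellPosed.traj_splice_right`: after time `s` the trajectory depends only on its
state at `s` and on the later controls). The latter needs that trajectories can be glued, that is,
that gluing preserves absolute continuity.

For a fixed partition, the iterated inf-sup of the cost (`upperValue`) is a function of the whole
past, whereas strategies may use only the current state. They lose nothing by this
(`WellPosed.exists_representative`): once the terminal set has been met the later controls are
irrelevant, and for two histories that have not met it and are in the same state, the costs of equal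
continuations differ by a constant, so that a near-optimal choice for one history is near-optimal
for the other. Choosing one representative history for each state gives near-optimal controls as
functions of the state, both for the operator and, given the operator's control, for nature. Their
errors add up over the finitely many moves, so the operator can guarantee the upper value of any
chosen partition and nature can secure the upper value of the partition that the operator has chosen,
up to an arbitrarily small error (`WellPosed.exists_operatorStrategy`,
`WellPosed.exists_natureStrategy`). If the operator takes a partition whose upper value is nearly the
infimum over all partitions, the two strategies form the saddle point.

No measurability in the state is required of a strategy, so these choices need no measurable
selection.
-/

/-! ### Absolutely continuous functions -/

theorem AbsolutelyContinuousOnInterval.congr {f g : ℝ → ℝ} {a b : ℝ}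
    (hf : AbsolutelyContinuousOnInterval f a b) (h : EqOn f g (uIcc a b)) :
    AbsolutelyContinuousOnInterval g a b := by
  rw [absolutelyContinuousOnInterval_iff] at hf ⊢
  intro ε hε
  obtain ⟨δ, hδ, H⟩ := hf ε hε
  refine ⟨δ, hδ, fun E hE hlen => ?_⟩
  convert H E hE hlen using 1
  refine Finset.sum_congr rfl fun i hi => ?_
  rw [h (hE.1 i hi).1, h (hE.1 i hi).2]

/-- Clamping the argument to the interval `[c, d]` maps disjoint intervals to disjoint intervals
and does not increase their lengths, so it preserves absolute continuity. -/
theorem AbsolutelyContinuousOnInterval.comp_clamp {f : ℝ → ℝ} {c d : ℝ} (hcd : c ≤ d)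
    (hf : AbsolutelyContinuousOnInterval f c d) (a b : ℝ) :
    AbsolutelyContinuousOnInterval (fun τ => f (max c (min d τ))) a b := by
  rw [absolutelyContinuousOnInterval_iff] at hf ⊢
  intro ε hε
  obtain ⟨δ, hδ, H⟩ := hf ε hε
  refine ⟨δ, hδ, fun E hE hlen => ?_⟩
  refine H (E.1, fun i => (max c (min d (E.2 i).1), max c (min d (E.2 i).2))) ⟨?_, ?_⟩ ?_
  · intro i _
    rw [uIcc_of_le hcd]
    simp [hcd]
  · intro i hi j hj hij
    refine (hE.2 hi hj hij).mono ?_ ?_ <;>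
    · intro z hz
      simp only [mem_uIoc] at hz ⊢
      grind
  · refine lt_of_le_of_lt (Finset.sum_le_sum fun i _ => ?_) hlen
    simp only [Real.dist_eq]
    grind

theorem AbsolutelyContinuousOnInterval.ite_le {f g : ℝ → ℝ} {a s b : ℝ} (has : a ≤ s) (hsb : s ≤ b)
    (hf : AbsolutelyContinuousOnInterval f a s) (hg : AbsolutelyContinuousOnInterval g s b)
    (hfg : f s = g s) :
    AbsolutelyContinuousOnInterval (fun τ => if τ ≤ s then f τ else g τ) a b := by
  have hconst : AbsolutelyContinuousOnInterval (fun _ : ℝ => f s) a b :=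
    (LipschitzWith.const (f s)).lipschitzOnWith.absolutelyContinuousOnInterval
  refine (((hf.comp_clamp has a b).add (hg.comp_clamp hsb a b)).sub hconst).congr fun τ hτ => ?_
  rw [uIcc_of_le (has.trans hsb)] at hτ
  simp only [Pi.add_apply, Pi.sub_apply]
  split_ifs with h
  · rw [min_eq_right h, max_eq_right hτ.1, min_eq_right hτ.2, max_eq_left h, hfg]
    ring
  · rw [not_le] at h
    rw [min_eq_left h.le, max_eq_right has, min_eq_right hτ.2, max_eq_right h.le]
    ring

/-! ### Controls on the whole line and their concatenation -/

/-- A control defined at all times: a measurable function `ℝ → X` with values in `S`. Controls over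
intervals are handled as restrictions of such functions. -/
structure TotalControl {X : Type*} [MeasurableSpace X] (S : Set X) where
  toFun : ℝ → X
  measurable' : Measurable toFun
  mem' : ∀ τ, toFun τ ∈ S

namespace TotalControl

variable {X : Type*} [MeasurableSpace X] {S : Set X}

def restrict (w : TotalControl S) (a b : ℝ) : Control S a b where
  toFun τ := w.toFun τ
  measurable' := w.measurable'.comp measurable_subtype_coe
  mem' τ := w.mem' τ

/-- The control that follows `w` before time `s` and `w'` from time `s` on. -/
noncomputable def splice (s : ℝ) (w w' : TotalControl S) : TotalControl S where
  toFun τ := if τ < s then w.toFun τ else w'.toFun τ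
  measurable' := Measurable.ite measurableSet_Iio w.measurable' w'.measurable'
  mem' τ := by
    split_ifs
    exacts [w.mem' τ, w'.mem' τ]

theorem nonempty (hS : S.Nonempty) : Nonempty (TotalControl S) :=
  hS.elim fun x hx => ⟨⟨fun _ => x, measurable_const, fun _ => hx⟩⟩

end TotalControl

namespace Control

variable {X : Type*} [MeasurableSpace X] {S : Set X} {a b : ℝ}

/-- The extension of a control over `[a, b]` to all times that is constant on each side of
the interval. -/
noncomputable def extend (h : a ≤ b) (c : Control S a b) : TotalControl S where
  toFun τ := c (projIcc a b h τ)
  measurable' := c.measurable'.comp continuous_projIcc.measurable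
  mem' _ := c.mem' _

theorem extend_apply (h : a ≤ b) (c : Control S a b) {τ : ℝ} (hτ : τ ∈ Icc a b) :
    (c.extend h).toFun τ = c ⟨τ, hτ⟩ := by
  simp [extend, projIcc_of_mem h hτ]

theorem restrict_extend (h : a ≤ b) (c : Control S a b) : (c.extend h).restrict a b = c := by
  cases c
  simp [extend, TotalControl.restrict]

end Control

theorem ae_timeMeasure_iff {a b : ℝ} {P : ℝ → Prop} :
    (∀ᵐ τ : Icc a b ∂(timeMeasure a b), P τ) ↔ ∀ᵐ τ : ℝ, τ ∈ Icc a b → P τ := by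
  rw [timeMeasure, ← ae_restrict_iff_subtype measurableSet_Icc, ae_restrict_iff' measurableSet_Icc]

namespace DryingGame

variable {A : Type*} [MeasurableSpace A] (G : DryingGame A)

/-- A pair of controls, one of the operator and one of nature, defined at all times. -/
abbrev Program : Type _ := TotalControl G.T × TotalControl G.Q

variable {G}

namespace Program

/-- The pair of values of the two controls at time `τ`. -/
def eval (p : G.Program) (τ : ℝ) : ℝ × A := (p.1.toFun τ, p.2.toFun τ)

/-- The pair of controls that follows `p` before time `s` and `q` from time `s` on. -/
noncomputable def splice (s : ℝ) (p q : G.Program) : G.Program :=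
  (p.1.splice s q.1, p.2.splice s q.2)

theorem eval_splice (s : ℝ) (p q : G.Program) (τ : ℝ) :
    (splice s p q).eval τ = if τ < s then p.eval τ else q.eval τ := by
  simp only [eval, splice, TotalControl.splice]
  split_ifs <;> rfl

theorem ext_eval {p q : G.Program} (h : ∀ τ, p.eval τ = q.eval τ) : p = q := by
  obtain ⟨⟨p₁, _, _⟩, ⟨p₂, _, _⟩⟩ := p
  obtain ⟨⟨q₁, _, _⟩, ⟨q₂, _, _⟩⟩ := q
  obtain rfl : p₁ = q₁ := funext fun τ => congrArg Prod.fst (h τ)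
  obtain rfl : p₂ = q₂ := funext fun τ => congrArg Prod.snd (h τ)
  rfl

theorem splice_splice {s t : ℝ} (hst : s ≤ t) (p q r : G.Program) :
    splice t (splice s p q) r = splice s p (splice t q r) := by
  refine ext_eval fun τ => ?_
  simp only [eval_splice]
  grind

theorem splice_splice_right (s : ℝ) (p q r : G.Program) :
    splice s (splice s p q) r = splice s p r := by
  refine ext_eval fun τ => ?_
  simp only [eval_splice]
  grind

theorem eqOn_splice_left (s : ℝ) (p q : G.Program) :
    EqOn (splice s p q).eval p.eval (Ico 0 s) := fun τ hτ => by
  rw [eval_splice, if_pos hτ.2]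

end Program

open Program

/-! ### Trajectories: causality and the Markov property -/

/-- `x` is a trajectory on `[0, s]` for the pair of controls `p`. -/
def IsTraj (s : ℝ) (p : G.Program) (x : ℝ → ℝ) : Prop :=
  G.IsTrajectory s (p.1.restrict 0 s) (p.2.restrict 0 s) x

theorem isTraj_iff {s : ℝ} {p : G.Program} {x : ℝ → ℝ} :
    IsTraj s p x ↔ AbsolutelyContinuousOnInterval x 0 s ∧ (∀ τ ∈ Icc 0 s, 0 ≤ x τ) ∧ x 0 = G.x₀ ∧
      ∀ᵐ τ : ℝ, τ ∈ Icc 0 s → HasDerivAt x (G.f (x τ) (p.eval τ).1 (p.eval τ).2) τ := by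
  have key := ae_timeMeasure_iff (a := 0) (b := s)
    (P := fun τ => HasDerivAt x (G.f (x τ) (p.eval τ).1 (p.eval τ).2) τ)
  constructor
  · rintro ⟨h₁, h₂, h₃, h₄⟩
    exact ⟨h₁, h₂, h₃, key.1 h₄⟩
  · rintro ⟨h₁, h₂, h₃, h₄⟩
    exact ⟨h₁, h₂, h₃, key.2 h₄⟩

theorem isTraj_extend_iff {s : ℝ} (hs : 0 ≤ s) {u : Control G.T 0 s} {v : Control G.Q 0 s}
    {x : ℝ → ℝ} :
    IsTraj s ((u.extend hs, v.extend hs) : G.Program) x ↔ G.IsTrajectory s u v x := by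
  simp only [IsTraj, Control.restrict_extend]

/-- The value of a control at the right end point of the interval is irrelevant. -/
theorem IsTraj.mono {s t : ℝ} (hs : 0 ≤ s) (hst : s ≤ t) {p q : G.Program} {x : ℝ → ℝ}
    (h : IsTraj t p x) (hpq : EqOn p.eval q.eval (Ico 0 s)) : IsTraj s q x := by
  rw [isTraj_iff] at h ⊢
  obtain ⟨h₁, h₂, h₃, h₄⟩ := h
  refine ⟨h₁.mono ?_, fun τ hτ => h₂ τ ⟨hτ.1, hτ.2.trans hst⟩, h₃, ?_⟩
  · rw [uIcc_of_le hs, uIcc_of_le (hs.trans hst)]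
    exact Icc_subset_Icc_right hst
  · filter_upwards [h₄, Measure.ae_ne volume s] with τ hτ hne hmem
    rw [← hpq ⟨hmem.1, lt_of_le_of_ne hmem.2 hne⟩]
    exact hτ ⟨hmem.1, hmem.2.trans hst⟩

theorem IsTraj.splice {s t : ℝ} (hs : 0 ≤ s) (hst : s ≤ t) {p q : G.Program} {x y : ℝ → ℝ}
    (hx : IsTraj t p x) (hy : IsTraj t q y) (hxy : x s = y s) :
    IsTraj t (Program.splice s p q) (fun τ => if τ ≤ s then x τ else y τ) := by
  rw [isTraj_iff] at *
  obtain ⟨x₁, x₂, x₃, x₄⟩ := hx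
  obtain ⟨y₁, y₂, y₃, y₄⟩ := hy
  refine ⟨AbsolutelyContinuousOnInterval.ite_le hs hst (x₁.mono ?_) (y₁.mono ?_) hxy, ?_, ?_, ?_⟩
  · rw [uIcc_of_le hs, uIcc_of_le (hs.trans hst)]
    exact Icc_subset_Icc_right hst
  · rw [uIcc_of_le hst, uIcc_of_le (hs.trans hst)]
    exact Icc_subset_Icc_left hs
  · intro τ hτ
    split_ifs
    exacts [x₂ τ hτ, y₂ τ hτ]
  · simp only [if_pos hs, x₃]
  · filter_upwards [x₄, y₄, Measure.ae_ne volume s] with τ hxτ hyτ hne hmem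
    rcases lt_or_gt_of_ne hne with h | h
    · rw [eval_splice, if_pos h, if_pos h.le]
      refine (hxτ hmem).congr_of_eventuallyEq ?_
      filter_upwards [Iio_mem_nhds h] with z hz
      exact if_pos (le_of_lt hz)
    · rw [eval_splice, if_neg h.not_gt, if_neg h.not_ge]
      refine (hyτ hmem).congr_of_eventuallyEq ?_
      filter_upwards [Ioi_mem_nhds h] with z hz
      exact if_neg (not_le.2 hz)

variable (G) in
/-- The standing assumptions on the game: unique trajectories, which all reach the terminal set,
and a well defined bounded energy cost. -/
structure WellPosed : Prop where
  J_pos : 0 < G.J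
  nonempty_T : G.T.Nonempty
  nonempty_Q : G.Q.Nonempty
  existsUnique_traj : ∀ s ∈ Icc 0 G.J, ∀ (u : Control G.T 0 s) (v : Control G.Q 0 s),
    ∃ x, G.IsTrajectory s u v x ∧ ∀ y, G.IsTrajectory s u v y → EqOn y x (Icc 0 s)
  reach : ∀ (u : Control G.T 0 G.J) (v : Control G.Q 0 G.J) (x : ℝ → ℝ),
    G.IsTrajectory G.J u v x → ∃ τ ∈ Icc 0 G.J, x τ ∈ G.terminal
  integrable : ∀ (u : Control G.T 0 G.J) (v : Control G.Q 0 G.J) (x : ℝ → ℝ),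
    G.IsTrajectory G.J u v x →
      IntegrableOn (fun τ : Icc 0 G.J => G.e (u τ) (v τ) (x τ) τ)
        {τ | (τ : ℝ) ≤ G.reachTime x} (timeMeasure 0 G.J)
  bounded : ∃ C : ℝ, ∀ (u : Control G.T 0 G.J) (v : Control G.Q 0 G.J) (x : ℝ → ℝ),
    G.IsTrajectory G.J u v x → |G.energy u v x| ≤ C

/-- The trajectory on `[0, J]` for the pair of controls `p`; outside `[0, J]` its values are
arbitrary. -/
noncomputable def traj (p : G.Program) : ℝ → ℝ := Classical.epsilon (IsTraj G.J p)

namespace WellPosed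

variable (hG : G.WellPosed)
include hG

theorem isTraj_traj (p : G.Program) : IsTraj G.J p (traj p) := by
  obtain ⟨x, hx, -⟩ := hG.existsUnique_traj G.J ⟨hG.J_pos.le, le_rfl⟩
    (p.1.restrict 0 G.J) (p.2.restrict 0 G.J)
  exact Classical.epsilon_spec (p := IsTraj G.J p) ⟨x, hx⟩

theorem eqOn_of_isTraj {s : ℝ} (hs : s ∈ Icc 0 G.J) {p : G.Program} {x y : ℝ → ℝ}
    (hx : IsTraj s p x) (hy : IsTraj s p y) : EqOn x y (Icc 0 s) := by
  obtain ⟨z, -, hz⟩ := hG.existsUnique_traj s hs (p.1.restrict 0 s) (p.2.restrict 0 s)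
  exact (hz x hx).trans (hz y hy).symm

theorem eqOn_traj {p : G.Program} {x : ℝ → ℝ} (hx : IsTraj G.J p x) :
    EqOn x (traj p) (Icc 0 G.J) :=
  hG.eqOn_of_isTraj ⟨hG.J_pos.le, le_rfl⟩ hx (hG.isTraj_traj p)

/-- Causality: the trajectory up to time `s` depends only on the controls before `s`. -/
theorem traj_congr {s : ℝ} (hs : s ∈ Icc 0 G.J) {p q : G.Program}
    (hpq : EqOn p.eval q.eval (Ico 0 s)) : EqOn (traj p) (traj q) (Icc 0 s) :=
  hG.eqOn_of_isTraj hs ((hG.isTraj_traj p).mono hs.1 hs.2 hpq)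
    ((hG.isTraj_traj q).mono hs.1 hs.2 fun _ _ => rfl)

theorem traj_splice_left {s : ℝ} (hs : s ∈ Icc 0 G.J) (p q : G.Program) :
    EqOn (traj (Program.splice s p q)) (traj p) (Icc 0 s) :=
  hG.traj_congr hs (eqOn_splice_left s p q)

/-- The Markov property: the trajectory after time `s` depends only on its value at `s` and on the
controls from `s` on. -/
theorem traj_splice_right {s : ℝ} (hs : s ∈ Icc 0 G.J) {p q : G.Program}
    (hpq : traj p s = traj q s) :
    EqOn (traj (Program.splice s p q)) (traj q) (Icc s G.J) := by
  intro τ hτ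
  rw [← hG.eqOn_traj ((hG.isTraj_traj p).splice hs.1 hs.2 (hG.isTraj_traj q) hpq)
    ⟨hs.1.trans hτ.1, hτ.2⟩]
  dsimp only
  split_ifs with h
  · rw [le_antisymm h hτ.1, hpq]
  · rfl

end WellPosed

/-! ### The energy cost as a function of the controls -/

theorem energy_congr (u : Control G.T 0 G.J) (v : Control G.Q 0 G.J) {x y : ℝ → ℝ}
    (h : EqOn x y (Icc 0 G.J)) : G.energy u v x = G.energy u v y := by
  have hr : G.reachTime x = G.reachTime y := by
    unfold reachTime
    congr 1
    ext τ
    exact and_congr_right fun hτ => by rw [h hτ]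
  simp only [energy, hr]
  congr 1
  funext τ
  rw [h τ.2]

/-- The energy cost of a pair of controls defined at all times. -/
noncomputable def cost (p : G.Program) : ℝ :=
  G.energy (p.1.restrict 0 G.J) (p.2.restrict 0 G.J) (traj p)

/-- The energy cost per unit of time along the trajectory of a pair of controls. -/
noncomputable def runningCost (p : G.Program) (τ : ℝ) : ℝ :=
  G.e (p.eval τ).1 (p.eval τ).2 (traj p τ) τ

/-- The trajectory of `p` meets the terminal set at or before time `s`. -/
def Hits (s : ℝ) (p : G.Program) : Prop := ∃ τ ∈ Icc 0 s, traj p τ ∈ G.terminal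

theorem bddBelow_reach (x : ℝ → ℝ) : BddBelow {τ | τ ∈ Icc 0 G.J ∧ x τ ∈ G.terminal} :=
  ⟨0, fun _ hτ => hτ.1.1⟩

theorem reachTime_le {s : ℝ} (hs : s ≤ G.J) {p : G.Program} (hp : Hits s p) :
    G.reachTime (traj p) ≤ s := by
  obtain ⟨τ, hτ, hmem⟩ := hp
  exact (csInf_le (bddBelow_reach _) ⟨⟨hτ.1, hτ.2.trans hs⟩, hmem⟩).trans hτ.2

/-- The terminal set need not be closed, so the reaching time is an infimum that need not be
attained; it is still determined by the trajectory up to any time by which the set was met. -/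
theorem reachTime_le_reachTime {s : ℝ} (hs : s ≤ G.J) {x y : ℝ → ℝ} (hxy : EqOn x y (Icc 0 s))
    (hx : ∃ τ ∈ Icc 0 s, x τ ∈ G.terminal) : G.reachTime x ≤ G.reachTime y := by
  obtain ⟨τ, hτ, hmem⟩ := hx
  refine le_csInf ⟨τ, ⟨hτ.1, hτ.2.trans hs⟩, hxy hτ ▸ hmem⟩ fun b hb => ?_
  rcases le_total b s with h | h
  · exact csInf_le (bddBelow_reach _) ⟨hb.1, by rw [hxy ⟨hb.1.1, h⟩]; exact hb.2⟩
  · exact (csInf_le (bddBelow_reach _) ⟨⟨hτ.1, hτ.2.trans hs⟩, hmem⟩).trans (hτ.2.trans h)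

namespace WellPosed

variable (hG : G.WellPosed)
include hG

theorem hits_J (p : G.Program) : Hits G.J p := hG.reach _ _ _ (hG.isTraj_traj p)

theorem cost_eq_integral (p : G.Program) :
    cost p = ∫ τ in Icc 0 (G.reachTime (traj p)), runningCost p τ := by
  -- The reaching time is at most `J`.
  have hset : Icc 0 (G.reachTime (traj p)) = Iic (G.reachTime (traj p)) ∩ Icc 0 G.J := by
    ext τ
    have := reachTime_le le_rfl (hG.hits_J p)
    simp only [mem_Icc, mem_inter_iff, mem_Iic]
    grind
  rw [hset, ← Measure.restrict_restrict measurableSet_Iic,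
    ← map_comap_subtype_coe measurableSet_Icc,
    (MeasurableEmbedding.subtype_coe measurableSet_Icc).setIntegral_map]
  rfl

theorem integrableOn_runningCost (p : G.Program) :
    IntegrableOn (runningCost p) (Icc 0 (G.reachTime (traj p))) := by
  have hset : Icc 0 (G.reachTime (traj p)) = Iic (G.reachTime (traj p)) ∩ Icc 0 G.J := by
    ext τ
    have := reachTime_le le_rfl (hG.hits_J p)
    simp only [mem_Icc, mem_inter_iff, mem_Iic]
    grind
  rw [hset, IntegrableOn, ← Measure.restrict_restrict measurableSet_Iic,
    ← map_comap_subtype_coe measurableSet_Icc, ← IntegrableOn,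
    (MeasurableEmbedding.subtype_coe measurableSet_Icc).integrableOn_map_iff]
  exact hG.integrable _ _ _ (hG.isTraj_traj p)

/-- Once the terminal set has been met, the later controls do not change the energy cost. -/
theorem cost_congr_of_hits {s : ℝ} (hs : s ∈ Icc 0 G.J) {p q : G.Program}
    (hpq : EqOn p.eval q.eval (Ico 0 s)) (hp : Hits s p) : cost p = cost q := by
  have htraj := hG.traj_congr hs hpq
  have hq : Hits s q := by
    obtain ⟨τ, hτ, hmem⟩ := hp
    exact ⟨τ, hτ, htraj hτ ▸ hmem⟩
  have hr : G.reachTime (traj p) = G.reachTime (traj q) :=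
    le_antisymm (reachTime_le_reachTime hs.2 htraj hp) (reachTime_le_reachTime hs.2 htraj.symm hq)
  rw [hG.cost_eq_integral, hG.cost_eq_integral, hr]
  refine setIntegral_congr_ae measurableSet_Icc ?_
  filter_upwards [Measure.ae_ne volume s] with τ hne hτ
  have hτs : τ ≤ s := hτ.2.trans (reachTime_le hs.2 hq)
  simp only [runningCost]
  rw [hpq ⟨hτ.1, lt_of_le_of_ne hτs hne⟩, htraj ⟨hτ.1, hτs⟩]

theorem cost_congr {p q : G.Program} (hpq : EqOn p.eval q.eval (Ico 0 G.J)) : cost p = cost q :=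
  hG.cost_congr_of_hits ⟨hG.J_pos.le, le_rfl⟩ hpq (hG.hits_J p)

/-- A continuation of a history that has not met the terminal set by time `s` costs what was spent
before `s` plus the cost of the part after `s`. -/
theorem cost_splice_eq_add {s : ℝ} (hs : s ∈ Icc 0 G.J) {p q : G.Program} (hp : ¬ Hits s p) :
    s ≤ G.reachTime (traj (Program.splice s p q)) ∧
    cost (Program.splice s p q) = (∫ τ in Ico 0 s, runningCost p τ) +
      ∫ τ in Icc s (G.reachTime (traj (Program.splice s p q))),
        runningCost (Program.splice s p q) τ := by
  have hle : s ≤ G.reachTime (traj (Program.splice s p q)) := by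
    obtain ⟨τ₀, hτ₀, hmem₀⟩ := hG.hits_J (Program.splice s p q)
    refine le_csInf ⟨τ₀, hτ₀, hmem₀⟩ fun τ hτ => ?_
    by_contra! hlt
    have hτs : τ ∈ Icc 0 s := ⟨hτ.1.1, hlt.le⟩
    exact hp ⟨τ, hτs, hG.traj_splice_left hs p q hτs ▸ hτ.2⟩
  refine ⟨hle, ?_⟩
  have hint := hG.integrableOn_runningCost (Program.splice s p q)
  rw [hG.cost_eq_integral, ← Ico_union_Icc_eq_Icc hs.1 hle] at *
  rw [setIntegral_union (by rw [disjoint_left]; intro τ h h'; exact h.2.not_ge h'.1)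
    measurableSet_Icc (hint.mono_set subset_union_left) (hint.mono_set subset_union_right)]
  congr 1
  refine setIntegral_congr_fun measurableSet_Ico fun τ hτ => ?_
  simp only [runningCost]
  rw [eqOn_splice_left s p q hτ, hG.traj_splice_left hs p q (Ico_subset_Icc_self hτ)]

/-- If two trajectories are in the same state at time `s` and neither has met the terminal set,
then the energy costs of their continuations by the same controls differ by a constant. -/
theorem exists_cost_splice_eq_add {s : ℝ} (hs : s ∈ Icc 0 G.J) {p p' : G.Program}
    (hp : ¬ Hits s p) (hp' : ¬ Hits s p') (hpp' : traj p s = traj p' s) :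
    ∃ c, ∀ q, cost (Program.splice s p q) = cost (Program.splice s p' q) + c := by
  refine ⟨(∫ τ in Ico 0 s, runningCost p τ) - ∫ τ in Ico 0 s, runningCost p' τ, fun q => ?_⟩
  have hss : s ∈ Icc 0 s := ⟨hs.1, le_rfl⟩
  have hl := hG.traj_splice_left hs p q
  have hl' := hG.traj_splice_left hs p' q
  have hr : EqOn (traj (Program.splice s p q)) (traj (Program.splice s p' q)) (Icc s G.J) := by
    have := hG.traj_splice_right hs (p := Program.splice s p' q) (q := Program.splice s p q)
      (by rw [hl hss, hl' hss, hpp'])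
    rw [splice_splice_right] at this
    refine EqOn.symm ?_
    convert this using 2
    exact ext_eval fun τ => by simp only [eval_splice]; grind
  have hreach : G.reachTime (traj (Program.splice s p q)) =
      G.reachTime (traj (Program.splice s p' q)) := by
    unfold reachTime
    congr 1
    ext τ
    refine and_congr_right fun hτ => ?_
    rcases le_total τ s with h | h
    · rw [hl ⟨hτ.1, h⟩, hl' ⟨hτ.1, h⟩]
      exact iff_of_false (fun hm => hp ⟨τ, ⟨hτ.1, h⟩, hm⟩) (fun hm => hp' ⟨τ, ⟨hτ.1, h⟩, hm⟩)
    · rw [hr ⟨h, hτ.2⟩]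
  rw [(hG.cost_splice_eq_add hs hp).2, (hG.cost_splice_eq_add hs hp').2, hreach]
  have htail : ∫ τ in Icc s (G.reachTime (traj (Program.splice s p' q))),
      runningCost (Program.splice s p q) τ =
      ∫ τ in Icc s (G.reachTime (traj (Program.splice s p' q))),
      runningCost (Program.splice s p' q) τ := by
    refine setIntegral_congr_fun measurableSet_Icc fun τ hτ => ?_
    have hτJ : τ ≤ G.J := hτ.2.trans (reachTime_le le_rfl (hG.hits_J _))
    simp only [runningCost]
    rw [hr ⟨hτ.1, hτJ⟩, eval_splice, eval_splice, if_neg hτ.1.not_gt, if_neg hτ.1.not_gt]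
  rw [htail]
  ring

/-- Every state at time `s` has a representative history `p₀`: any history `p` that leads to this
state either has already met the terminal set, so that the future does not matter, or the costs of
its continuations are those of the continuations of `p₀` up to a constant. -/
theorem exists_representative {s : ℝ} (hs : s ∈ Icc 0 G.J) (y : ℝ) :
    ∃ p₀ : G.Program, ∀ p : G.Program, traj p s = y →
      (∃ c, ∀ q, cost (Program.splice s p q) = cost (Program.splice s p₀ q) + c) ∨
      ∃ c, ∀ q, cost (Program.splice s p q) = c := by
  have hhit : ∀ p : G.Program, Hits s p → ∃ c, ∀ q, cost (Program.splice s p q) = c :=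
    fun p hp => ⟨cost p, fun q =>
      (hG.cost_congr_of_hits hs (eqOn_splice_left s p q).symm hp).symm⟩
  by_cases h : ∃ p₀ : G.Program, ¬ Hits s p₀ ∧ traj p₀ s = y
  · obtain ⟨p₀, hp₀, hy⟩ := h
    refine ⟨p₀, fun p hp => ?_⟩
    by_cases hps : Hits s p
    · exact Or.inr (hhit p hps)
    · exact Or.inl (hG.exists_cost_splice_eq_add hs hps hp₀ (hp.trans hy.symm))
  · push Not at h
    obtain ⟨u⟩ := TotalControl.nonempty hG.nonempty_T
    obtain ⟨v⟩ := TotalControl.nonempty hG.nonempty_Q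
    refine ⟨(u, v), fun p hp => Or.inr (hhit p ?_)⟩
    by_contra hps
    exact h p hps hp

theorem abs_cost_le : ∃ C, ∀ p : G.Program, |cost p| ≤ C := by
  obtain ⟨C, hC⟩ := hG.bounded
  exact ⟨C, fun p => hC _ _ _ (hG.isTraj_traj p)⟩

end WellPosed

/-! ### Inf-sup values of bounded functions -/

section InfSup

variable {U V : Type*} {F : U → V → ℝ} {C : ℝ}

theorem bddAbove_of_abs_le (hF : ∀ u v, |F u v| ≤ C) (u : U) : BddAbove (range (F u)) :=
  ⟨C, forall_mem_range.2 fun v => (abs_le.1 (hF u v)).2⟩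

variable [Nonempty V]

theorem abs_iSup_le (hF : ∀ u v, |F u v| ≤ C) (u : U) : |⨆ v, F u v| ≤ C :=
  abs_le.2 ⟨(abs_le.1 (hF u (Classical.arbitrary V))).1.trans
    (le_ciSup (bddAbove_of_abs_le hF u) _), ciSup_le fun v => (abs_le.1 (hF u v)).2⟩

theorem bddBelow_iSup_of_abs_le (hF : ∀ u v, |F u v| ≤ C) : BddBelow (range fun u => ⨆ v, F u v) :=
  ⟨-C, forall_mem_range.2 fun u => (abs_le.1 (abs_iSup_le hF u)).1⟩

variable [Nonempty U]

theorem abs_iInf_iSup_le (hF : ∀ u v, |F u v| ≤ C) : |⨅ u, ⨆ v, F u v| ≤ C :=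
  abs_le.2 ⟨le_ciInf fun u => (abs_le.1 (abs_iSup_le hF u)).1,
    (ciInf_le (bddBelow_iSup_of_abs_le hF) (Classical.arbitrary U)).trans
      (abs_le.1 (abs_iSup_le hF _)).2⟩

theorem exists_forall_le_iInf_iSup_add (hF : ∀ u v, |F u v| ≤ C) {δ : ℝ} (hδ : 0 < δ) :
    ∃ u, ∀ v, F u v ≤ (⨅ u, ⨆ v, F u v) + δ := by
  obtain ⟨u, hu⟩ := exists_lt_of_ciInf_lt (lt_add_of_pos_right (⨅ u, ⨆ v, F u v) hδ)
  exact ⟨u, fun v => (le_ciSup (bddAbove_of_abs_le hF u) v).trans hu.le⟩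

theorem exists_iInf_iSup_le_add (hF : ∀ u v, |F u v| ≤ C) {δ : ℝ} (hδ : 0 < δ) (u : U) :
    ∃ v, (⨅ u, ⨆ v, F u v) ≤ F u v + δ := by
  obtain ⟨v, hv⟩ := exists_lt_of_lt_ciSup (sub_lt_self (⨆ v, F u v) hδ)
  refine ⟨v, (ciInf_le (bddBelow_iSup_of_abs_le hF) u).trans ?_⟩
  linarith

theorem iInf_iSup_add_const (hF : ∀ u v, |F u v| ≤ C) (c : ℝ) :
    ⨅ u, ⨆ v, (F u v + c) = (⨅ u, ⨆ v, F u v) + c := by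
  rw [ciInf_add (bddBelow_iSup_of_abs_le hF)]
  exact iInf_congr fun u => (ciSup_add (bddAbove_of_abs_le hF u) c).symm

end InfSup

/-! ### The value functions of the upper game for a fixed partition -/

/-- The upper value with `m` moves to go when move `k` takes place at time `t k` and the
controls `p` have been used before that time: at each move the operator chooses a control first
and nature answers. It is written in terms of the total cost, including the part already spent. -/
noncomputable def upperValue (t : ℕ → ℝ) : ℕ → ℕ → G.Program → ℝ
  | 0, _, p => cost p
  | m + 1, k, p => ⨅ u, ⨆ v, upperValue t m (k + 1) (Program.splice (t k) p (u, v))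

namespace WellPosed

variable (hG : G.WellPosed)
include hG

theorem abs_upperValue_le {C : ℝ} (hC : ∀ p : G.Program, |cost p| ≤ C) (t : ℕ → ℝ) (m k : ℕ)
    (p : G.Program) : |upperValue t m k p| ≤ C := by
  have := TotalControl.nonempty hG.nonempty_T
  have := TotalControl.nonempty hG.nonempty_Q
  induction m generalizing k p with
  | zero => exact hC p
  | succ m ih => exact abs_iInf_iSup_le fun u v => ih _ _

/-- The value before move `k` depends only on the controls before time `t k`. The total time must be
used up by the remaining moves, so that the cost depends on nothing later. -/
theorem upperValue_congr {t : ℕ → ℝ} {m k : ℕ} (ht : t (k + m) = G.J) {p q : G.Program}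
    (hpq : EqOn p.eval q.eval (Ico 0 (t k))) : upperValue t m k p = upperValue t m k q := by
  induction m generalizing k p q with
  | zero => exact hG.cost_congr (by rwa [← ht])
  | succ m ih =>
    refine iInf_congr fun u => iSup_congr fun v => ih (by rw [← ht]; congr 1; ring) fun τ hτ => ?_
    simp only [eval_splice]
    split_ifs with h
    exacts [hpq ⟨hτ.1, h⟩, rfl]

theorem upperValue_splice_of_cost_eq_add {t : ℕ → ℝ} (htm : Monotone t) {s c : ℝ}
    {p p' : G.Program}
    (h : ∀ q, cost (Program.splice s p q) = cost (Program.splice s p' q) + c)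
    (m : ℕ) {k : ℕ} (hk : s ≤ t k) (q : G.Program) :
    upperValue t m k (Program.splice s p q) = upperValue t m k (Program.splice s p' q) + c := by
  have := TotalControl.nonempty hG.nonempty_T
  have := TotalControl.nonempty hG.nonempty_Q
  obtain ⟨C, hC⟩ := hG.abs_cost_le
  induction m generalizing k q with
  | zero => exact h q
  | succ m ih =>
    simp only [upperValue, splice_splice hk, ih (hk.trans (htm k.le_succ))]
    exact iInf_iSup_add_const (fun u v => hG.abs_upperValue_le hC _ _ _ _) c

theorem upperValue_splice_of_cost_eq {t : ℕ → ℝ} (htm : Monotone t) {s c : ℝ}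
    {p : G.Program} (h : ∀ q, cost (Program.splice s p q) = c)
    (m : ℕ) {k : ℕ} (hk : s ≤ t k) (q : G.Program) :
    upperValue t m k (Program.splice s p q) = c := by
  have := TotalControl.nonempty hG.nonempty_T
  have := TotalControl.nonempty hG.nonempty_Q
  induction m generalizing k q with
  | zero => exact h q
  | succ m ih => simp only [upperValue, splice_splice hk, ih (hk.trans (htm k.le_succ)), ciSup_const,
      ciInf_const]

/-- A near-optimal control of the operator at move `k` can be chosen as a function of the state. -/
theorem exists_operator_control {t : ℕ → ℝ} (htm : Monotone t) {k : ℕ} (hk : t k ∈ Icc 0 G.J)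
    (m : ℕ) {δ : ℝ} (hδ : 0 < δ) (y : ℝ) :
    ∃ u : TotalControl G.T, ∀ p : G.Program, traj p (t k) = y → ∀ v,
      upperValue t m (k + 1) (Program.splice (t k) p (u, v)) ≤ upperValue t (m + 1) k p + δ := by
  have := TotalControl.nonempty hG.nonempty_T
  have := TotalControl.nonempty hG.nonempty_Q
  obtain ⟨C, hC⟩ := hG.abs_cost_le
  have hk' : t k ≤ t (k + 1) := htm k.le_succ
  obtain ⟨p₀, hp₀⟩ := hG.exists_representative hk y
  have hB : ∀ u v, |upperValue t m (k + 1) (Program.splice (t k) p₀ (u, v))| ≤ C :=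
    fun u v => hG.abs_upperValue_le hC _ _ _ _
  obtain ⟨u, hu⟩ := exists_forall_le_iInf_iSup_add hB hδ
  refine ⟨u, fun p hp v => ?_⟩
  rcases hp₀ p hp with ⟨c, hc⟩ | ⟨c, hc⟩
  · simp only [upperValue, hG.upperValue_splice_of_cost_eq_add htm hc m hk',
      iInf_iSup_add_const hB c]
    linarith [hu v]
  · simp only [upperValue, hG.upperValue_splice_of_cost_eq htm hc m hk', ciSup_const, ciInf_const]
    linarith

/-- A near-optimal answer of nature at move `k` can be chosen as a function of the state and of the
operator's control. -/
theorem exists_nature_control {t : ℕ → ℝ} (htm : Monotone t) {k : ℕ} (hk : t k ∈ Icc 0 G.J)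
    (m : ℕ) {δ : ℝ} (hδ : 0 < δ) (y : ℝ) (u : TotalControl G.T) :
    ∃ v : TotalControl G.Q, ∀ p : G.Program, traj p (t k) = y →
      upperValue t (m + 1) k p ≤ upperValue t m (k + 1) (Program.splice (t k) p (u, v)) + δ := by
  have := TotalControl.nonempty hG.nonempty_T
  have := TotalControl.nonempty hG.nonempty_Q
  obtain ⟨C, hC⟩ := hG.abs_cost_le
  have hk' : t k ≤ t (k + 1) := htm k.le_succ
  obtain ⟨p₀, hp₀⟩ := hG.exists_representative hk y
  have hB : ∀ u v, |upperValue t m (k + 1) (Program.splice (t k) p₀ (u, v))| ≤ C :=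
    fun u v => hG.abs_upperValue_le hC _ _ _ _
  obtain ⟨v, hv⟩ := exists_iInf_iSup_le_add hB hδ u
  refine ⟨v, fun p hp => ?_⟩
  rcases hp₀ p hp with ⟨c, hc⟩ | ⟨c, hc⟩
  · simp only [upperValue, hG.upperValue_splice_of_cost_eq_add htm hc m hk',
      iInf_iSup_add_const hB c]
    linarith
  · simp only [upperValue, hG.upperValue_splice_of_cost_eq htm hc m hk', ciSup_const, ciInf_const]
    linarith

end WellPosed

end DryingGame

/-! ### Partitions with all natural numbers as indices -/

namespace TimePartition

variable {J : ℝ} (σ : TimePartition J)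

/-- The points of the partition, continued by the constant value `J` beyond the last index. -/
def time (k : ℕ) : ℝ := σ.t ⟨min k σ.n, by omega⟩

theorem time_monotone : Monotone σ.time := fun _ _ h =>
  σ.strictMono'.monotone (Fin.mk_le_mk.2 (min_le_min_right _ h))

theorem time_zero : σ.time 0 = 0 := by
  rw [← σ.t_zero]
  simp [time]

theorem time_last : σ.time σ.n = J := by
  refine Eq.trans ?_ σ.t_last
  simp [time, Fin.last]

theorem time_castSucc (k : Fin σ.n) : σ.t k.castSucc = σ.time k := by
  unfold time
  congr 1
  ext
  simp

theorem time_succ (k : Fin σ.n) : σ.t k.succ = σ.time (k + 1) := by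
  unfold time
  congr 1
  ext
  simp only [Fin.val_succ]
  omega

theorem t_castSucc_le_succ (k : Fin σ.n) : σ.t k.castSucc ≤ σ.t k.succ :=
  σ.strictMono'.monotone k.castSucc_lt_succ.le

theorem time_mem {k : ℕ} (hk : k ≤ σ.n) : σ.time k ∈ Icc 0 J :=
  ⟨σ.time_zero ▸ σ.time_monotone k.zero_le, (σ.time_monotone hk).trans_eq σ.time_last⟩

theorem nonempty (hJ : 0 < J) : Nonempty (TimePartition J) :=
  ⟨⟨1, ![0, J], by
    intro i j hij
    obtain ⟨rfl, rfl⟩ : i = 0 ∧ j = 1 := by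
      rw [Fin.lt_def] at hij
      constructor <;> ext <;> simp <;> omega
    simpa using hJ, rfl, rfl⟩⟩

end TimePartition

namespace DryingGame

variable {A : Type*} [MeasurableSpace A] {G : DryingGame A}

open Program

/-! ### Plays in terms of controls defined at all times -/

/-- The operator's control at move `k` in state `y`, extended to all times. -/
noncomputable def OperatorStrategy.move (S : G.OperatorStrategy) (k : Fin S.σ.n) (y : ℝ) :
    TotalControl G.T :=
  (S.φ k y).extend (S.σ.t_castSucc_le_succ k)

/-- Nature's answer to the strategy `S` at move `k` in state `y`, extended to all times. -/
noncomputable def NatureStrategy.answer (N : G.NatureStrategy) (S : G.OperatorStrategy)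
    (k : Fin S.σ.n) (y : ℝ) : TotalControl G.Q :=
  (N S.σ k y (S.φ k y)).extend (S.σ.t_castSucc_le_succ k)

/-- During move `k`, the controls `p` are those that the strategies prescribe. -/
def FollowsAt (S : G.OperatorStrategy) (N : G.NatureStrategy) (p : G.Program) (k : Fin S.σ.n) :
    Prop :=
  EqOn p.eval (Program.eval (S.move k (traj p (S.σ.time k)), N.answer S k (traj p (S.σ.time k))))
    (Ico (S.σ.time k) (S.σ.time (k + 1)))

theorem mem_Icc_of_mem_move {σ : TimePartition G.J} {k : Fin σ.n} {τ : ℝ}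
    (hτ : τ ∈ Ico (σ.time k) (σ.time (k + 1))) :
    τ ∈ Icc 0 G.J ∧ τ ∈ Icc (σ.t k.castSucc) (σ.t k.succ) := by
  refine ⟨⟨(σ.time_mem k.2.le).1.trans hτ.1, hτ.2.le.trans (σ.time_mem k.2).2⟩, ?_⟩
  rw [σ.time_castSucc, σ.time_succ]
  exact Ico_subset_Icc_self hτ

theorem isPlay_of_followsAt (hG : G.WellPosed) {S : G.OperatorStrategy} {N : G.NatureStrategy}
    {p : G.Program} (h : ∀ k, FollowsAt S N p k) :
    IsPlay S N (p.1.restrict 0 G.J) (p.2.restrict 0 G.J) (traj p) := by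
  have key : ∀ (k : Fin S.σ.n) (τ : ℝ), τ ∈ Icc (S.σ.t k.castSucc) (S.σ.t k.succ) →
      τ < S.σ.t k.succ → p.eval τ = Program.eval
        (S.move k (traj p (S.σ.t k.castSucc)), N.answer S k (traj p (S.σ.t k.castSucc))) τ := by
    intro k τ hk hlt
    have := @h k τ
    rw [← S.σ.time_castSucc, ← S.σ.time_succ] at this
    exact this ⟨hk.1, hlt⟩
  refine ⟨hG.isTraj_traj p, fun k τ _ hk hlt => ?_, fun k τ _ hk hlt => ?_⟩
  · exact (congrArg Prod.fst (key k τ hk hlt)).trans (Control.extend_apply _ _ hk)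
  · exact (congrArg Prod.snd (key k τ hk hlt)).trans (Control.extend_apply _ _ hk)

namespace WellPosed

variable (hG : G.WellPosed)
include hG

/-- The pair of extensions of the two controls to all times. -/
noncomputable def program (u : Control G.T 0 G.J) (v : Control G.Q 0 G.J) : G.Program :=
  (u.extend hG.J_pos.le, v.extend hG.J_pos.le)

theorem eqOn_traj_program {u : Control G.T 0 G.J} {v : Control G.Q 0 G.J} {x : ℝ → ℝ}
    (hx : G.IsTrajectory G.J u v x) : EqOn x (traj (hG.program u v)) (Icc 0 G.J) :=
  hG.eqOn_traj ((isTraj_extend_iff _).2 hx)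

theorem energy_eq_cost {u : Control G.T 0 G.J} {v : Control G.Q 0 G.J} {x : ℝ → ℝ}
    (hx : G.IsTrajectory G.J u v x) : G.energy u v x = cost (hG.program u v) := by
  rw [energy_congr u v (hG.eqOn_traj_program hx)]
  simp only [cost, program, Control.restrict_extend]

theorem eqOn_move {S : G.OperatorStrategy} {u : Control G.T 0 G.J} {v : Control G.Q 0 G.J}
    {x : ℝ → ℝ} (hx : G.IsTrajectory G.J u v x) (hS : S.Follows u x) (k : Fin S.σ.n) :
    EqOn (hG.program u v).1.toFun (S.move k (traj (hG.program u v) (S.σ.time k))).toFun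
      (Ico (S.σ.time k) (S.σ.time (k + 1))) := by
  intro τ hτ
  obtain ⟨h, hk⟩ := mem_Icc_of_mem_move hτ
  rw [← hG.eqOn_traj_program hx (S.σ.time_mem k.2.le), ← S.σ.time_castSucc]
  exact (Control.extend_apply _ _ h).trans <|
    (hS k τ h hk (by rw [S.σ.time_succ]; exact hτ.2)).trans (Control.extend_apply _ _ hk).symm

theorem followsAt_program {S : G.OperatorStrategy} {N : G.NatureStrategy} {u : Control G.T 0 G.J}
    {v : Control G.Q 0 G.J} {x : ℝ → ℝ} (h : IsPlay S N u v x) (k : Fin S.σ.n) :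
    FollowsAt S N (hG.program u v) k := by
  intro τ hτ
  refine Prod.ext (hG.eqOn_move h.traj h.operator k hτ) ?_
  obtain ⟨hJ, hk⟩ := mem_Icc_of_mem_move hτ
  rw [← hG.eqOn_traj_program h.traj (S.σ.time_mem k.2.le), ← S.σ.time_castSucc]
  exact (Control.extend_apply _ _ hJ).trans <|
    (h.nature k τ hJ hk (by rw [S.σ.time_succ]; exact hτ.2)).trans
      (Control.extend_apply _ _ hk).symm

/-! ### Existence and uniqueness of the play -/

/-- The play is built move by move: the controls of each move are determined by the state that
the earlier ones lead to. -/
theorem exists_followsAt (S : G.OperatorStrategy) (N : G.NatureStrategy) :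
    ∃ p : G.Program, ∀ k, FollowsAt S N p k := by
  suffices H : ∀ j ≤ S.σ.n, ∃ p : G.Program, ∀ k : Fin S.σ.n, (k : ℕ) < j → FollowsAt S N p k by
    obtain ⟨p, hp⟩ := H S.σ.n le_rfl
    exact ⟨p, fun k => hp k k.2⟩
  intro j
  induction j with
  | zero =>
    obtain ⟨u⟩ := TotalControl.nonempty hG.nonempty_T
    obtain ⟨v⟩ := TotalControl.nonempty hG.nonempty_Q
    exact fun _ => ⟨(u, v), fun k hk => absurd hk (Nat.not_lt_zero _)⟩
  | succ j ih =>
    intro hj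
    obtain ⟨p, hp⟩ := ih (Nat.le_of_succ_le hj)
    have hmem := S.σ.time_mem (Nat.le_of_succ_le hj)
    let i : Fin S.σ.n := ⟨j, hj⟩
    let q : G.Program := (S.move i (traj p (S.σ.time j)), N.answer S i (traj p (S.σ.time j)))
    refine ⟨Program.splice (S.σ.time j) p q, fun k hk => ?_⟩
    have hkj : (k : ℕ) ≤ j := Nat.le_of_lt_succ hk
    have htraj : traj (Program.splice (S.σ.time j) p q) (S.σ.time k) = traj p (S.σ.time k) :=
      hG.traj_splice_left hmem p q ⟨(S.σ.time_mem k.2.le).1, S.σ.time_monotone hkj⟩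
    rcases hkj.lt_or_eq with hlt | heq
    · intro τ hτ
      rw [htraj, eval_splice, if_pos (hτ.2.trans_le (S.σ.time_monotone hlt))]
      exact hp k hlt hτ
    · obtain rfl : k = i := Fin.ext heq
      intro τ hτ
      rw [htraj, eval_splice, if_neg hτ.1.not_gt]

theorem eqOn_eval_of_followsAt {S : G.OperatorStrategy} {N : G.NatureStrategy} {p q : G.Program}
    (hp : ∀ k, FollowsAt S N p k) (hq : ∀ k, FollowsAt S N q k) :
    EqOn p.eval q.eval (Ico 0 G.J) := by
  suffices H : ∀ j ≤ S.σ.n, EqOn p.eval q.eval (Ico 0 (S.σ.time j)) by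
    simpa only [S.σ.time_last] using H S.σ.n le_rfl
  intro j
  induction j with
  | zero => simp [S.σ.time_zero]
  | succ j ih =>
    intro hj τ hτ
    have hj' := Nat.le_of_succ_le hj
    have hmem := S.σ.time_mem hj'
    rcases lt_or_ge τ (S.σ.time j) with h | h
    · exact ih hj' ⟨hτ.1, h⟩
    · have hstate := hG.traj_congr hmem (ih hj') ⟨hmem.1, le_rfl⟩
      have h₁ := hp ⟨j, hj⟩ ⟨h, hτ.2⟩
      have h₂ := hq ⟨j, hj⟩ ⟨h, hτ.2⟩
      rw [h₁, h₂, hstate]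

theorem exists_isPlay (S : G.OperatorStrategy) (N : G.NatureStrategy) :
    ∃ u v x, IsPlay S N u v x :=
  have ⟨_, hp⟩ := hG.exists_followsAt S N
  ⟨_, _, _, isPlay_of_followsAt hG hp⟩

theorem isPlay_unique {S : G.OperatorStrategy} {N : G.NatureStrategy}
    {u u' : Control G.T 0 G.J} {v v' : Control G.Q 0 G.J} {x x' : ℝ → ℝ}
    (h : IsPlay S N u v x) (h' : IsPlay S N u' v' x') :
    EqOn x x' (Icc 0 G.J) ∧ u =ᵐ[timeMeasure 0 G.J] u' ∧ v =ᵐ[timeMeasure 0 G.J] v' ∧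
      G.energy u v x = G.energy u' v' x' := by
  have heq := hG.eqOn_eval_of_followsAt (hG.followsAt_program h) (hG.followsAt_program h')
  have hJ : G.J ∈ Icc 0 G.J := ⟨hG.J_pos.le, le_rfl⟩
  have hne : ∀ᵐ τ : Icc 0 G.J ∂(timeMeasure 0 G.J), (τ : ℝ) ≠ G.J := by
    refine ae_timeMeasure_iff (P := fun τ => τ ≠ G.J) |>.2 ?_
    filter_upwards [Measure.ae_ne volume G.J] with τ hτ _ using hτ
  have hpt : ∀ τ : Icc 0 G.J, (τ : ℝ) ≠ G.J → u τ = u' τ ∧ v τ = v' τ := fun τ hτ => by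
    have := heq ⟨τ.2.1, lt_of_le_of_ne τ.2.2 hτ⟩
    have h₁ := congrArg Prod.fst this
    have h₂ := congrArg Prod.snd this
    simp only [Program.eval, program, Control.extend_apply _ _ τ.2] at h₁ h₂
    exact ⟨h₁, h₂⟩
  refine ⟨?_, ?_, ?_, ?_⟩
  · exact ((hG.eqOn_traj_program h.traj).trans (hG.traj_congr hJ heq)).trans
      (hG.eqOn_traj_program h'.traj).symm
  · filter_upwards [hne] with τ hτ using (hpt τ hτ).1
  · filter_upwards [hne] with τ hτ using (hpt τ hτ).2
  · rw [hG.energy_eq_cost h.traj, hG.energy_eq_cost h'.traj, hG.cost_congr heq]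

/-- The payoff is defined through an arbitrarily chosen play; any other play has the same cost. -/
theorem energy_eq_payoff {S : G.OperatorStrategy} {N : G.NatureStrategy}
    {u : Control G.T 0 G.J} {v : Control G.Q 0 G.J} {x : ℝ → ℝ} (h : IsPlay S N u v x) :
    G.energy u v x = payoff S N := by
  have hex : ∃ p : Control G.T 0 G.J × Control G.Q 0 G.J × (ℝ → ℝ), IsPlay S N p.1 p.2.1 p.2.2 :=
    ⟨(u, v, x), h⟩
  rw [payoff, dif_pos hex]
  exact (hG.isPlay_unique h hex.choose_spec).2.2.2

end WellPosed

/-! ### Near-optimal strategies -/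

/-- Errors of size `δ` at each of `n` moves add up to `n * δ`. -/
theorem le_add_mul_of_forall_le_add {n : ℕ} {W : ℕ → ℕ → ℝ} {δ : ℝ}
    (h : ∀ m k, k + (m + 1) = n → W m (k + 1) ≤ W (m + 1) k + δ) : W 0 n ≤ W n 0 + n * δ := by
  suffices H : ∀ m k, k + m = n → W 0 n ≤ W m k + m * δ from H n 0 (zero_add n)
  intro m
  induction m with
  | zero =>
    rintro k rfl
    simp
  | succ m ih =>
    intro k hk
    have h₁ := ih (k + 1) (by omega)
    have h₂ := h m k hk
    push_cast
    linarith

namespace WellPosed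

variable (hG : G.WellPosed)
include hG

theorem upperValue_zero_eq (σ : TimePartition G.J) (p q : G.Program) :
    upperValue σ.time σ.n 0 p = upperValue σ.time σ.n 0 q :=
  hG.upperValue_congr (by rw [zero_add, σ.time_last]) (by simp [σ.time_zero])

/-- For each partition the operator has a strategy that guarantees the upper value of the partition
up to `ε`, whatever control nature uses. -/
theorem exists_operatorStrategy (σ : TimePartition G.J) {ε : ℝ} (hε : 0 < ε) :
    ∃ S : G.OperatorStrategy, ∀ (u : Control G.T 0 G.J) (v : Control G.Q 0 G.J) (x : ℝ → ℝ),
      G.IsTrajectory G.J u v x → S.Follows u x → ∀ p₀ : G.Program,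
        G.energy u v x ≤ upperValue σ.time σ.n 0 p₀ + ε := by
  have hn : (0 : ℝ) < σ.n + 1 := by positivity
  choose w hw using fun (k : Fin σ.n) => hG.exists_operator_control σ.time_monotone
    (σ.time_mem k.2.le) (σ.n - 1 - k) (div_pos hε hn)
  refine ⟨⟨σ, fun k y => (w k y).restrict _ _⟩, fun u v x hx hS p₀ => ?_⟩
  rw [hG.energy_eq_cost hx, hG.upperValue_zero_eq σ p₀ (hG.program u v)]
  set p := hG.program u v
  have step : ∀ m k, k + (m + 1) = σ.n →
      upperValue σ.time m (k + 1) p ≤ upperValue σ.time (m + 1) k p + ε / (σ.n + 1) := by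
    intro m k hkm
    let i : Fin σ.n := ⟨k, by omega⟩
    have hi := hw i (traj p (σ.time k)) p rfl p.2
    rw [show σ.n - 1 - (i : ℕ) = m by simp only [i]; omega] at hi
    -- Replacing the operator's control from time `t k` on by the near-optimal one for move `k`
    -- does not change `p` before time `t (k + 1)`, which is all that the value depends on.
    refine le_of_eq_of_le (hG.upperValue_congr ?_ fun τ hτ => ?_) hi
    · rw [show k + 1 + m = σ.n by omega, σ.time_last]
    · rw [eval_splice]
      split_ifs with h
      · rfl
      · have hmem : τ ∈ Ico (σ.time i) (σ.time (i + 1)) := ⟨not_lt.1 h, hτ.2⟩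
        refine Prod.ext ((hG.eqOn_move hx hS i hmem).trans ?_) rfl
        exact Control.extend_apply _ _ (mem_Icc_of_mem_move hmem).2
  refine (le_add_mul_of_forall_le_add (W := fun m k => upperValue σ.time m k p) step).trans ?_
  have : σ.n * (ε / (σ.n + 1)) ≤ ε := by
    rw [mul_div_assoc', div_le_iff₀ hn]
    linarith
  linarith

/-- Nature has a strategy that, against every strategy of the operator, secures the upper value of
the operator's partition up to `ε`. -/
theorem exists_natureStrategy {ε : ℝ} (hε : 0 < ε) :
    ∃ N : G.NatureStrategy, ∀ (S : G.OperatorStrategy) (u : Control G.T 0 G.J)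
      (v : Control G.Q 0 G.J) (x : ℝ → ℝ), IsPlay S N u v x → ∀ p₀ : G.Program,
        upperValue S.σ.time S.σ.n 0 p₀ ≤ G.energy u v x + ε := by
  have hn : ∀ σ : TimePartition G.J, (0 : ℝ) < σ.n + 1 := fun σ => by positivity
  choose w hw using fun (σ : TimePartition G.J) (k : Fin σ.n) =>
    hG.exists_nature_control σ.time_monotone (σ.time_mem k.2.le) (σ.n - 1 - k) (div_pos hε (hn σ))
  refine ⟨fun σ k y c => (w σ k y (c.extend (σ.t_castSucc_le_succ k))).restrict _ _,
    fun S u v x hplay p₀ => ?_⟩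
  rw [hG.energy_eq_cost hplay.traj, hG.upperValue_zero_eq S.σ p₀ (hG.program u v)]
  set p := hG.program u v
  have step : ∀ m k, k + (m + 1) = S.σ.n → -upperValue S.σ.time m (k + 1) p ≤
      -upperValue S.σ.time (m + 1) k p + ε / (S.σ.n + 1) := by
    intro m k hkm
    let i : Fin S.σ.n := ⟨k, by omega⟩
    have hi := hw S.σ i (traj p (S.σ.time k)) (S.move i (traj p (S.σ.time k))) p rfl
    rw [show S.σ.n - 1 - (i : ℕ) = m by simp only [i]; omega] at hi
    -- The same replacement as for the operator, with both controls of move `k`.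
    have hcongr : upperValue S.σ.time m (k + 1) p = upperValue S.σ.time m (k + 1)
        (Program.splice (S.σ.time i) p (S.move i (traj p (S.σ.time k)),
          w S.σ i (traj p (S.σ.time k)) (S.move i (traj p (S.σ.time k))))) := by
      refine hG.upperValue_congr ?_ fun τ hτ => ?_
      · rw [show k + 1 + m = S.σ.n by omega, S.σ.time_last]
      · rw [eval_splice]
        split_ifs with h
        · rfl
        · have hmem : τ ∈ Ico (S.σ.time i) (S.σ.time (i + 1)) := ⟨not_lt.1 h, hτ.2⟩
          refine (hG.followsAt_program hplay i hmem).trans (Prod.ext rfl ?_)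
          exact Control.extend_apply (S.σ.t_castSucc_le_succ i) ((w S.σ i _ _).restrict _ _)
            (mem_Icc_of_mem_move hmem).2
    rw [hcongr]
    linarith
  have := le_add_mul_of_forall_le_add (W := fun m k => -upperValue S.σ.time m k p) step
  have hle : S.σ.n * (ε / (S.σ.n + 1)) ≤ ε := by
    rw [mul_div_assoc', div_le_iff₀ (hn S.σ)]
    linarith
  simp only [upperValue] at this
  linarith

/-- The value of the upper game is the infimum over all partitions of their upper values; the
operator uses a partition that attains it up to `ε / 4`. -/
theorem exists_saddlePoint {ε : ℝ} (hε : 0 < ε) :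
    ∃ (Sε : G.OperatorStrategy) (Nε : G.NatureStrategy),
      (∀ S, payoff Sε Nε ≤ payoff S Nε + ε) ∧
      ∀ (u : Control G.T 0 G.J) (v : Control G.Q 0 G.J) (x : ℝ → ℝ),
        G.IsTrajectory G.J u v x → Sε.Follows u x → G.energy u v x ≤ payoff Sε Nε + ε := by
  obtain ⟨u₀⟩ := TotalControl.nonempty hG.nonempty_T
  obtain ⟨v₀⟩ := TotalControl.nonempty hG.nonempty_Q
  have := TimePartition.nonempty hG.J_pos
  obtain ⟨C, hC⟩ := hG.abs_cost_le
  let val : TimePartition G.J → ℝ := fun σ => upperValue σ.time σ.n 0 (u₀, v₀)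
  have hbdd : BddBelow (range val) :=
    ⟨-C, forall_mem_range.2 fun σ => (abs_le.1 (hG.abs_upperValue_le hC σ.time σ.n 0 _)).1⟩
  obtain ⟨σ, hσ⟩ := exists_lt_of_ciInf_lt (lt_add_of_pos_right (⨅ σ, val σ) (show 0 < ε / 4 by
    positivity))
  obtain ⟨Sε, hSε⟩ := hG.exists_operatorStrategy σ (show 0 < ε / 4 by positivity)
  obtain ⟨Nε, hNε⟩ := hG.exists_natureStrategy (show 0 < ε / 2 by positivity)
  have lower : ∀ S, (⨅ σ, val σ) ≤ payoff S Nε + ε / 2 := by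
    intro S
    obtain ⟨u, v, x, h⟩ := hG.exists_isPlay S Nε
    rw [← hG.energy_eq_payoff h]
    exact (ciInf_le hbdd S.σ).trans (hNε S u v x h _)
  have upper : ∀ (u : Control G.T 0 G.J) (v : Control G.Q 0 G.J) (x : ℝ → ℝ),
      G.IsTrajectory G.J u v x → Sε.Follows u x → G.energy u v x ≤ (⨅ σ, val σ) + ε / 2 := by
    intro u v x hx hS
    have := hSε u v x hx hS (u₀, v₀)
    change G.energy u v x ≤ val σ + ε / 4 at this
    linarith
  refine ⟨Sε, Nε, fun S => ?_, fun u v x hx hS => ?_⟩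
  · obtain ⟨u, v, x, h⟩ := hG.exists_isPlay Sε Nε
    have := upper u v x h.traj h.operator
    rw [hG.energy_eq_payoff h] at this
    linarith [lower S]
  · linarith [upper u v x hx hS, lower Sε]

end WellPosed

end DryingGame

theorem mainTheorem1 {A : Type*} [MetricSpace A] [MeasurableSpace A] [BorelSpace A]
    (G : DryingGame A) (hJ : 0 < G.J)
    (hT : IsCompact G.T) (hT_nonempty : G.T.Nonempty) (hT_nonneg : G.T ⊆ Ici 0)
    (hQ : IsCompact G.Q) (hQ_nonempty : G.Q.Nonempty)
    (hx₀ : 0 ≤ G.x₀) (h_terminal : G.terminal ⊆ Ici 0)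
    -- to every pair of admissible controls corresponds one and only one trajectory
    (h_traj : ∀ s ∈ Icc 0 G.J, ∀ (u : Control G.T 0 s) (v : Control G.Q 0 s),
      ∃ x, G.IsTrajectory s u v x ∧ ∀ y, G.IsTrajectory s u v y → EqOn y x (Icc 0 s))
    -- every trajectory reaches the terminal set before or at the time `J`
    (h_reach : ∀ (u : Control G.T 0 G.J) (v : Control G.Q 0 G.J) (x : ℝ → ℝ),
      G.IsTrajectory G.J u v x → ∃ τ ∈ Icc 0 G.J, x τ ∈ G.terminal)
    -- the energy cost is well defined and bounded
    (h_int : ∀ (u : Control G.T 0 G.J) (v : Control G.Q 0 G.J) (x : ℝ → ℝ),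
      G.IsTrajectory G.J u v x →
        IntegrableOn (fun τ : Icc 0 G.J => G.e (u τ) (v τ) (x τ) τ)
          {τ | (τ : ℝ) ≤ G.reachTime x} (timeMeasure 0 G.J))
    (h_bdd : ∃ C : ℝ, ∀ (u : Control G.T 0 G.J) (v : Control G.Q 0 G.J) (x : ℝ → ℝ),
      G.IsTrajectory G.J u v x → |G.energy u v x| ≤ C) :
    -- every pair of strategies generates essentially one play; the payoff is its energy cost
    (∀ (S : G.OperatorStrategy) (N : G.NatureStrategy),
      (∃ u v x, DryingGame.IsPlay S N u v x) ∧
      (∀ u v x u' v' x', DryingGame.IsPlay S N u v x → DryingGame.IsPlay S N u' v' x' →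
        EqOn x x' (Icc 0 G.J) ∧ u =ᵐ[timeMeasure 0 G.J] u' ∧ v =ᵐ[timeMeasure 0 G.J] v') ∧
      (∀ u v x, DryingGame.IsPlay S N u v x → G.energy u v x = DryingGame.payoff S N)) ∧
    -- for every `ε > 0` there is an `ε`-saddle point
    (∀ ε : ℝ, 0 < ε → ∃ (Sε : G.OperatorStrategy) (Nε : G.NatureStrategy),
      (∀ N : G.NatureStrategy,
        DryingGame.payoff Sε N - ε ≤ DryingGame.payoff Sε Nε) ∧
      (∀ S : G.OperatorStrategy,
        DryingGame.payoff Sε Nε ≤ DryingGame.payoff S Nε + ε) ∧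
      -- guaranteed bound, whatever admissible control nature uses
      (∀ (u : Control G.T 0 G.J) (v : Control G.Q 0 G.J) (x : ℝ → ℝ),
        G.IsTrajectory G.J u v x → Sε.Follows u x →
          G.energy u v x ≤ DryingGame.payoff Sε Nε + ε)) := by
  have hG : G.WellPosed := ⟨hJ, hT_nonempty, hQ_nonempty, h_traj, h_reach, h_int, h_bdd⟩
  refine ⟨fun S N => ⟨hG.exists_isPlay S N, fun u v x u' v' x' h h' => ?_,
    fun u v x h => hG.energy_eq_payoff h⟩, fun ε hε => ?_⟩
  · obtain ⟨h₁, h₂, h₃, -⟩ := hG.isPlay_unique h h'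
    exact ⟨h₁, h₂, h₃⟩
  · obtain ⟨Sε, Nε, hS, hN⟩ := hG.exists_saddlePoint hε
    -- A play against a strategy of nature is a special case of the guaranteed bound.
    refine ⟨Sε, Nε, fun N => ?_, hS, hN⟩
    obtain ⟨u, v, x, h⟩ := hG.exists_isPlay Sε N
    rw [← hG.energy_eq_payoff h]
    linarith [hN u v x h.traj h.operator]
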